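/- Let $(W,H,\mu_W)$ be an abstract Wiener space: $W$ is a separable real Banach space, $H$ a separable real Hilbert space continuously and densely embedded in $W$, so that $W^*\subset H\subset W$, where $e\in W^*$ is identified with the element of $H$ satisfying $(e,h)_H=\langle h,e\rangle$ for $h\in H$; and $\mu_W$ is a Borel probability measure on $W$ under which $w\mapsto\langle w,e\rangle$ is $N(0,|e|_H^2)$ for every $e\in W^*$. Let $\mu_X$ be a Borel probability measure on $H$ such that $x\in W^*$ for $\mu_X$-almost every $x$, $\int_H e^{\alpha (x,h)_H}\,\mu_X(dx)<\infty$ for all $\alpha\in\mathbb R$ and $h\in W^*$, and $\int_H|x|_H^2\,\mu_X(dx)<\infty$. On $H\times W$ with the product measure $\mu_X\times\mu_W$ (expectation $E$), let $x$ and $w$ be the coordinates and, for $\rho\in\mathbb R$, let $y=\rho x+w$. Let $\mu_Y$ be the law of $y$ on $W$, let $\mu_{X,Y}$ be the joint law of $(x,y)$, let $E(x\mid Y)$ be the $H$-valued conditional expectation of $x$ given the $\sigma$-field generated by $y$, and let $$I(X;Y)=\int_{H\times W}\log\frac{d\mu_{X,Y}}{d(\mu_X\times\mu_Y)}\,d\mu_{X,Y}.$$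 Then, for every $\rho\in\mathbb R$: (i) $\mu_{X,Y}\ll\mu_X\times\mu_Y$ and the integral defining $I(X;Y)$ converges absolutely; $E|E(x\mid Y)|_H^2$ and $E|x-E(x\mid Y)|_H^2$ are finite; the function $\rho\mapsto I(X;Y)$ is differentiable, and $$\frac{dI(X;Y)}{d\rho}=\rho\,E\left(|x|_H^2-|E(x\mid Y)|_H^2\right)=\rho\,E\left|x-E(x\mid Y)\right|_H^2 .$$ (ii) $\mu_Y\ll\mu_W$, and with $\ell=d\mu_Y/d\mu_W$ the function $\log\ell$ is $\mu_Y$-integrable and $$I(X;Y)=\frac{\rho^2}{2}E|x|_H^2-\int_W\log\ell\,d\mu_Y .$$ -/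

import Mathlib

open MeasureTheory ProbabilityTheory

noncomputable section

namespace GaussianChannel

/-- The canonical map from the dual `W*` to `H` attached to a continuous linear map `ι : H → W`:
`dualToH ι e` is the Riesz representative of `e ∘ ι`, so that `⟪dualToH ι e, h⟫ = e (ι h)`. -/
def dualToH {H W : Type*} [NormedAddCommGroup H] [InnerProductSpace ℝ H] [CompleteSpace H]
    [NormedAddCommGroup W] [NormedSpace ℝ W] (ι : H →L[ℝ] W) (e : W →L[ℝ] ℝ) : H :=
  (InnerProductSpace.toDual ℝ H).symm (e.comp ι)

theorem inner_dualToH {H W : Type*} [NormedAddCommGroup H] [InnerProductSpace ℝ H]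
    [CompleteSpace H] [NormedAddCommGroup W] [NormedSpace ℝ W] (ι : H →L[ℝ] W)
    (e : W →L[ℝ] ℝ) (h : H) : inner ℝ (dualToH ι e) h = e (ι h) := by
  simp [dualToH]

/-- `(W, H, μW)` is an abstract Wiener space: the Hilbert space `H` is continuously (through `ι`)
and densely embedded in the Banach space `W`, and under the law `μW` each `e ∈ W*` is a centred
Gaussian variable of variance `|e|_H²`, where `W*` is viewed in `H` through `dualToH ι`. (Injectivity
and density of the range of `dualToH ι` follow from the density of the range of `ι` and from the
injectivity of `ι` respectively.) -/
structure IsAbstractWienerSpace {H W : Type*} [NormedAddCommGroup H] [InnerProductSpace ℝ H]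
    [CompleteSpace H] [NormedAddCommGroup W] [NormedSpace ℝ W] [MeasurableSpace W]
    (ι : H →L[ℝ] W) (μW : Measure W) : Prop where
  injective : Function.Injective ι
  denseRange : DenseRange ι
  map_eq_gaussian : ∀ e : W →L[ℝ] ℝ, μW.map e = gaussianReal 0 (‖dualToH ι e‖₊ ^ 2)

/-- The mutual information `I(X;Y)` of two random variables on `(Ω, P)`: the integral, under the
joint law, of the logarithm of the density of the joint law with respect to the product of the
marginal laws. (`llr μ ν` is `log (dμ/dν)`.) -/
def mutualInfo {Ω 𝓧 𝓨 : Type*} [MeasurableSpace Ω] [MeasurableSpace 𝓧] [MeasurableSpace 𝓨]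
    (P : Measure Ω) (X : Ω → 𝓧) (Y : Ω → 𝓨) : ℝ :=
  ∫ p, llr (P.map fun ω => (X ω, Y ω)) ((P.map X).prod (P.map Y)) p
    ∂(P.map fun ω => (X ω, Y ω))

section Channel

variable {H W : Type*} [NormedAddCommGroup H] [InnerProductSpace ℝ H]
  [NormedAddCommGroup W] [NormedSpace ℝ W] [MeasurableSpace H] [MeasurableSpace W]

/-- The signal `x` on the canonical space `Θ = H × W`. -/
def signal : H × W → H := Prod.fst

/-- The channel output `y = ρ x + w` on the canonical space `Θ = H × W`. -/
def output (ι : H →L[ℝ] W) (ρ : ℝ) : H × W → W := fun θ => ρ • ι θ.1 + θ.2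

/-- The law `μ_Y` of the output, where `θ = (x, w)` has law `μX × μW`. -/
def outputLaw (ι : H →L[ℝ] W) (μX : Measure H) (μW : Measure W) (ρ : ℝ) : Measure W :=
  (μX.prod μW).map (output ι ρ)

/-- The likelihood ratio `ℓ = dμ_Y / dμ_W`. -/
def likelihoodRatio (ι : H →L[ℝ] W) (μX : Measure H) (μW : Measure W) (ρ : ℝ) (w : W) : ℝ :=
  ((outputLaw ι μX μW ρ).rnDeriv μW w).toReal

/-- The non-causal estimate `E(x | Y)`, where `Y` is the sigma field generated by the output. -/
def estimate [CompleteSpace H] (ι : H →L[ℝ] W) (μX : Measure H)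
    (μW : Measure W) (ρ : ℝ) : H × W → H :=
  (μX.prod μW)[(signal : H × W → H) | MeasurableSpace.comap (output ι ρ) inferInstance]

/-- The mutual information `I(X;Y)` of the channel, as a function of `ρ`. -/
def channelInfo (ι : H →L[ℝ] W) (μX : Measure H) (μW : Measure W) (ρ : ℝ) : ℝ :=
  mutualInfo (μX.prod μW) (signal : H × W → H) (output ι ρ)

end Channel

end GaussianChannel

end

/-!
Write `y_r = r x + w`, and let `Λ_r(x, w) = exp (r ⟨w, x⟩ - r² |x|² / 2)`. By the Cameron–Martin
formula (`IsAbstractWienerSpace.map_add_dualToH`) the law of `(x, y_r)` has density `Λ_r` with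
respect to `μX × μW` (`map_signal_output`), hence the law of `y_r` has density
`ℓ_r(w) = ∫ Λ_r(x, w) μX(dx)` with respect to `μW`, and the mutual information is
`E log Λ_r(x, y_r) - E log ℓ_r(y_r) = r² / 2 E|x|² - D(r)` with `D(r) = E log ℓ_r(y_r)`
(`channelInfo_eq`). The negative part of the logarithm of a density is integrable under the law with
that density; applied to `ℓ_r` and to `Λ_r / ℓ_r` this shows that all these logarithms are
integrable.

It remains to show that `D'(r) = r E|E(x | Y)|²`. No differentiation under the integral sign and no
integration by parts is needed, since the right-hand side is a subgradient of `D` at every `r`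
(`outputEntropy_subgradient`). By Gibbs' inequality `D(s) ≥ E log ℓ_r(y_s)`. Moreover
`y_s = y_r + (s - r) x`, and a shift of the argument of `ℓ_r` by `h` averages `exp (r (x, h))` over
the posterior law, so that Jensen's inequality gives
`log ℓ_r(y_s) ≥ log ℓ_r(y_r) + r (s - r) (E(x | Y), x)`, where `E(x | Y)` is the posterior mean by
Bayes' formula (`estimate_ae_eq`). As `E (E(x | Y), x) = E|E(x | Y)|²`, taking expectations gives
`D(s) ≥ D(r) + (s - r) r E|E(x | Y)|²`.

A function with a continuous choice of subgradients is differentiable, so it suffices that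
`r ↦ E|E(x | Y)|²` is continuous (`continuous_estimateEnergy`). By Scheffé's lemma `Λ_s → Λ_r` in
`L¹` with the weight `1 + |x|²`. Hence the unnormalized posterior means and energies converge in
`L¹(μW)`, and the energies dominate the integrand `ℓ_s |E(x | Y)|²`.
-/

open MeasureTheory ProbabilityTheory

noncomputable section

namespace GaussianChannel

open Filter Topology
open scoped ENNReal NNReal

set_option linter.unusedSectionVars false

/-! ### The Cameron–Martin formula -/

section CameronMartin

variable {H W : Type*} [NormedAddCommGroup H] [InnerProductSpace ℝ H] [CompleteSpace H]
  [NormedAddCommGroup W] [NormedSpace ℝ W]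

theorem dualToH_add (ι : H →L[ℝ] W) (e f : W →L[ℝ] ℝ) :
    dualToH ι (e + f) = dualToH ι e + dualToH ι f := by
  simp [dualToH, ContinuousLinearMap.add_comp]

theorem dualToH_smul (ι : H →L[ℝ] W) (r : ℝ) (e : W →L[ℝ] ℝ) :
    dualToH ι (r • e) = r • dualToH ι e := by
  simp [dualToH, ContinuousLinearMap.smul_comp]

variable [MeasurableSpace W] {ι : H →L[ℝ] W} {μW : Measure W}

theorem IsAbstractWienerSpace.mgf_eq (hW : IsAbstractWienerSpace ι μW) (e : W →L[ℝ] ℝ) (t : ℝ) :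
    mgf e μW t = Real.exp (t ^ 2 * ‖dualToH ι e‖ ^ 2 / 2) := by
  rw [mgf_gaussianReal (hW.map_eq_gaussian e)]
  simp; ring_nf

theorem IsAbstractWienerSpace.integral_exp (hW : IsAbstractWienerSpace ι μW) (e : W →L[ℝ] ℝ) :
    ∫ w, Real.exp (e w) ∂μW = Real.exp (‖dualToH ι e‖ ^ 2 / 2) := by
  simpa [mgf] using hW.mgf_eq e 1

theorem IsAbstractWienerSpace.integrable_exp (hW : IsAbstractWienerSpace ι μW)
    (e : W →L[ℝ] ℝ) : Integrable (fun w => Real.exp (e w)) μW := by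
  by_contra h
  have := hW.integral_exp e
  rw [integral_undef h] at this
  exact (Real.exp_pos _).ne this

variable [BorelSpace W]

theorem IsAbstractWienerSpace.memLp_two (hW : IsAbstractWienerSpace ι μW) (e : W →L[ℝ] ℝ) :
    MemLp e 2 μW := by
  have h := memLp_id_gaussianReal (μ := 0) (v := ‖dualToH ι e‖₊ ^ 2) 2
  rw [← hW.map_eq_gaussian e] at h
  exact (memLp_map_measure_iff (g := id) (by fun_prop) (by fun_prop)).1 h

theorem IsAbstractWienerSpace.integral_eq_zero (hW : IsAbstractWienerSpace ι μW)
    (e : W →L[ℝ] ℝ) : ∫ w, e w ∂μW = 0 := by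
  have h := integral_id_gaussianReal (μ := 0) (v := ‖dualToH ι e‖₊ ^ 2)
  rw [← hW.map_eq_gaussian e, integral_map (by fun_prop) (by fun_prop)] at h
  simpa using h

theorem IsAbstractWienerSpace.integral_sq (hW : IsAbstractWienerSpace ι μW)
    (e : W →L[ℝ] ℝ) : ∫ w, e w ^ 2 ∂μW = ‖dualToH ι e‖ ^ 2 := by
  have h := variance_id_gaussianReal (μ := 0) (v := ‖dualToH ι e‖₊ ^ 2)
  rw [← hW.map_eq_gaussian e, variance_eq_integral (by fun_prop),
    integral_map (by fun_prop) (by fun_prop), hW.map_eq_gaussian e] at h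
  simpa using h

/-- Finite measures on `W` are determined by the moment generating functions of the continuous
linear functionals, provided that all of these are finite: the functions extend analytically to
the imaginary axis, where they give the characteristic functional. -/
theorem ext_of_mgf_dual [CompleteSpace W] [SecondCountableTopology W] {μ ν : Measure W}
    [IsProbabilityMeasure μ] [IsFiniteMeasure ν]
    (hint : ∀ (f : W →L[ℝ] ℝ), Integrable (fun w => Real.exp (f w)) μ)
    (h : ∀ f : W →L[ℝ] ℝ, ∫ w, Real.exp (f w) ∂μ = ∫ w, Real.exp (f w) ∂ν) : μ = ν := by
  apply Measure.ext_of_charFunDual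
  ext f
  have hmgf : mgf f μ = mgf f ν := by
    ext t
    simpa [mgf] using h (t • f)
  have hset : integrableExpSet f μ = Set.univ := by
    ext t
    simpa [integrableExpSet] using hint (t • f)
  have := eqOn_complexMGF_of_mgf hmgf (x := Complex.I) (by simp [hset])
  simpa [complexMGF, charFunDual_apply, mul_comm] using this

/-- The **Cameron–Martin formula**, for shifts by the elements of `W*`. -/
theorem IsAbstractWienerSpace.map_add_dualToH [CompleteSpace W] [SecondCountableTopology W]
    [IsProbabilityMeasure μW] (hW : IsAbstractWienerSpace ι μW) (e : W →L[ℝ] ℝ) :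
    μW.map (fun w => ι (dualToH ι e) + w) =
      μW.withDensity fun w => ENNReal.ofReal (Real.exp (e w - ‖dualToH ι e‖ ^ 2 / 2)) := by
  have htilt : (μW.withDensity fun w =>
      ENNReal.ofReal (Real.exp (e w - ‖dualToH ι e‖ ^ 2 / 2))) = μW.tilted e := by
    simp only [Measure.tilted, hW.integral_exp e, Real.exp_sub]
  rw [htilt]
  have : IsProbabilityMeasure (μW.map fun w => ι (dualToH ι e) + w) :=
    Measure.isProbabilityMeasure_map (by fun_prop)
  have := isProbabilityMeasure_tilted (hW.integrable_exp e)
  apply ext_of_mgf_dual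
  · intro f
    rw [integrable_map_measure (by fun_prop) (by fun_prop)]
    simpa [Function.comp_def, Real.exp_add] using (hW.integrable_exp f).const_mul _
  · intro f
    rw [integral_exp_tilted, integral_map (by fun_prop) (by fun_prop), hW.integral_exp e]
    have h1 : ∫ w, Real.exp ((⇑e + ⇑f) w) ∂μW = Real.exp (‖dualToH ι (e + f)‖ ^ 2 / 2) :=
      hW.integral_exp (e + f)
    rw [h1, ← Real.exp_sub]
    simp only [map_add, Real.exp_add, integral_const_mul, hW.integral_exp]
    rw [← Real.exp_add, dualToH_add, norm_add_sq_real, ← inner_dualToH ι f,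
      real_inner_comm]
    ring_nf

end CameronMartin

/-! ### A measurable version of the pairing of `x ∈ W*` with `w ∈ W` -/

section Pairing

variable {H W : Type*} [NormedAddCommGroup H] [InnerProductSpace ℝ H] [CompleteSpace H]
  [NormedAddCommGroup W] [NormedSpace ℝ W] [MeasurableSpace H] [MeasurableSpace W]

/-- `B` chooses, jointly measurably, for `μX`-almost every `x` a functional `B x ∈ W*` which
represents `x`, so that `B x w` is the pairing `⟨w, x⟩`. -/
structure IsPairing (ι : H →L[ℝ] W) (μX : Measure H) (B : H → W →L[ℝ] ℝ) : Prop where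
  measurable : Measurable fun p : H × W => B p.1 p.2
  dualToH_eq : ∀ᵐ x ∂μX, dualToH ι (B x) = x

/-- A pairing exists as soon as `x ∈ W*` almost surely: `⟨w, x⟩` is the limit of the inner products
of `x` with `H`-valued simple functions whose images in `W` tend to `w`. -/
theorem exists_isPairing [SecondCountableTopology H] [BorelSpace H] [SecondCountableTopology W]
    [BorelSpace W] (ι : H →L[ℝ] W) (hι : DenseRange ι) (μX : Measure H)
    (hX : ∀ᵐ x ∂μX, x ∈ Set.range (dualToH ι)) : ∃ B, IsPairing ι μX B := by
  classical
  obtain ⟨T, hT, hTm, hTX⟩ : ∃ T : Set H, (∀ x ∈ T, x ∈ Set.range (dualToH ι)) ∧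
      MeasurableSet T ∧ ∀ᵐ x ∂μX, x ∈ T := by
    obtain ⟨s, hs, hsm, hs0⟩ := exists_measurable_superset_of_null (ae_iff.1 hX)
    refine ⟨sᶜ, fun x hx => ?_, hsm.compl, ?_⟩
    · by_contra h
      exact hx (hs h)
    · rw [ae_iff]; simpa using hs0
  choose! e he using hT
  refine ⟨fun x => if x ∈ T then e x else 0, ?_, ?_⟩
  · let φ : ℕ → W → H := fun n => (Function.invFun ι) ∘ (SimpleFunc.approxOn (id : W → W)
      measurable_id (Set.range ι) (ι 0) ⟨0, rfl⟩ n)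
    have hφm : ∀ n, Measurable (φ n) := fun n => by
      have := ((SimpleFunc.approxOn (id : W → W)
        measurable_id (Set.range ι) (ι 0) ⟨0, rfl⟩ n).map (Function.invFun ι)).measurable
      rwa [SimpleFunc.coe_map] at this
    have hφ : ∀ w, Tendsto (fun n => ι (φ n w)) atTop (𝓝 w) := fun w => by
      have h1 := SimpleFunc.tendsto_approxOn (f := (id : W → W)) measurable_id
        (s := Set.range ι) (y₀ := ι 0) ⟨0, rfl⟩ (x := w) (hι w)
      refine h1.congr fun n => ?_
      exact (Function.invFun_eq (SimpleFunc.approxOn_mem measurable_id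
        (s := Set.range ι) (y₀ := ι 0) ⟨0, rfl⟩ n w)).symm
    refine measurable_of_tendsto_metrizable (f := fun n (p : H × W) =>
      T.indicator (fun x => inner ℝ x (φ n p.2)) p.1) (fun n => ?_) ?_
    · have : Measurable (Set.indicator (Prod.fst ⁻¹' T : Set (H × W))
          fun p : H × W => (inner ℝ p.1 (φ n p.2) : ℝ)) :=
        (measurable_fst.inner ((hφm n).comp measurable_snd)).indicator (measurable_fst hTm)
      exact this
    · rw [tendsto_pi_nhds]
      rintro ⟨x, w⟩
      by_cases hx : x ∈ T
      · simp only [hx, Set.indicator_of_mem, if_true]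
        have : ∀ n, inner ℝ x (φ n w) = e x (ι (φ n w)) := fun n => by
          rw [← inner_dualToH, he x hx]
        simp only [this]
        exact ((e x).continuous.tendsto w).comp (hφ w)
      · simp [hx]
  · filter_upwards [hTX] with x hx
    simp [hx, he x hx]

end Pairing

/-! ### The densities of the channel -/

section Density

variable {H W : Type*} [NormedAddCommGroup H] [InnerProductSpace ℝ H]
  [NormedAddCommGroup W] [NormedSpace ℝ W]

/-- The density `exp (r ⟨w, x⟩ - r² |x|² / 2)` at `p = (x, w)` of the joint law of `(x, y)` with
respect to `μX × μW`, where `y = r x + w`. -/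
def jointDensity (B : H → W →L[ℝ] ℝ) (r : ℝ) (p : H × W) : ℝ :=
  Real.exp (r * B p.1 p.2 - r ^ 2 * ‖p.1‖ ^ 2 / 2)

/-- The density of the law of `y = r x + w` with respect to `μW`. On the `μW`-null set of those `w`
for which the joint density is not integrable over the signal, the value is `0`. -/
def outputDensity [MeasurableSpace H] (μX : Measure H) (B : H → W →L[ℝ] ℝ) (r : ℝ) (w : W) : ℝ :=
  ∫ x, jointDensity B r (x, w) ∂μX

/-- The unnormalized posterior mean of `x` when `w` is observed. -/
def weightedMean [MeasurableSpace H] (μX : Measure H) (B : H → W →L[ℝ] ℝ) (r : ℝ) (w : W) : H :=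
  ∫ x, jointDensity B r (x, w) • x ∂μX

/-- The unnormalized posterior second moment of `x` when `w` is observed. -/
def weightedEnergy [MeasurableSpace H] (μX : Measure H) (B : H → W →L[ℝ] ℝ) (r : ℝ) (w : W) : ℝ :=
  ∫ x, jointDensity B r (x, w) * ‖x‖ ^ 2 ∂μX

/-- The posterior mean of `x` when `w` is observed: Bayes' formula for `E(x | Y)`.
It is `0` on the `μW`-null set where the output density vanishes. -/
def posteriorMean [MeasurableSpace H] (μX : Measure H) (B : H → W →L[ℝ] ℝ) (r : ℝ) (w : W) : H :=
  (outputDensity μX B r w)⁻¹ • weightedMean μX B r w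

theorem jointDensity_pos (B : H → W →L[ℝ] ℝ) (r : ℝ) (p : H × W) : 0 < jointDensity B r p :=
  Real.exp_pos _

theorem log_jointDensity (B : H → W →L[ℝ] ℝ) (r : ℝ) (p : H × W) :
    Real.log (jointDensity B r p) = r * B p.1 p.2 - r ^ 2 * ‖p.1‖ ^ 2 / 2 :=
  Real.log_exp _

theorem outputDensity_nonneg [MeasurableSpace H] (μX : Measure H) (B : H → W →L[ℝ] ℝ) (r : ℝ)
    (w : W) : 0 ≤ outputDensity μX B r w :=
  integral_nonneg fun _ => (jointDensity_pos _ _ _).le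

end Density

section Channel

variable {H W : Type*} [NormedAddCommGroup H] [InnerProductSpace ℝ H] [CompleteSpace H]
  [SecondCountableTopology H] [MeasurableSpace H] [BorelSpace H]
  [NormedAddCommGroup W] [NormedSpace ℝ W] [CompleteSpace W]
  [SecondCountableTopology W] [MeasurableSpace W] [BorelSpace W]
  {ι : H →L[ℝ] W} {μW : Measure W} [IsProbabilityMeasure μW]
  {μX : Measure H} [IsProbabilityMeasure μX] {B : H → W →L[ℝ] ℝ}

theorem measurable_output (ι : H →L[ℝ] W) (r : ℝ) : Measurable (output ι r) := by
  unfold output; fun_prop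

theorem measurable_signal_output (ι : H →L[ℝ] W) (r : ℝ) :
    Measurable fun θ : H × W => (signal θ, output ι r θ) :=
  measurable_fst.prodMk (measurable_output ι r)

theorem IsPairing.measurable_jointDensity (hB : IsPairing ι μX B) (r : ℝ) :
    Measurable (jointDensity B r) := by
  have := hB.measurable
  unfold jointDensity
  fun_prop

theorem IsPairing.stronglyMeasurable_outputDensity (hB : IsPairing ι μX B) (r : ℝ) :
    StronglyMeasurable (outputDensity μX B r) :=
  (hB.measurable_jointDensity r).stronglyMeasurable.integral_prod_left'

theorem IsPairing.stronglyMeasurable_weightedMean (hB : IsPairing ι μX B) (r : ℝ) :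
    StronglyMeasurable (weightedMean μX B r) :=
  ((hB.measurable_jointDensity r).smul measurable_fst).stronglyMeasurable.integral_prod_left'

theorem IsPairing.stronglyMeasurable_posteriorMean (hB : IsPairing ι μX B) (r : ℝ) :
    StronglyMeasurable (posteriorMean μX B r) :=
  (hB.stronglyMeasurable_outputDensity r).measurable.inv.stronglyMeasurable.smul
    (hB.stronglyMeasurable_weightedMean r)

theorem IsPairing.ae_apply_eq_inner (hB : IsPairing ι μX B) :
    ∀ᵐ x ∂μX, ∀ h : H, B x (ι h) = inner ℝ x h := by
  filter_upwards [hB.dualToH_eq] with x hx h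
  rw [← inner_dualToH, hx]

/-- Given `x`, the output is the shift of `w` by the Cameron–Martin vector `r x`. -/
theorem map_signal_output (hW : IsAbstractWienerSpace ι μW) (hB : IsPairing ι μX B) (r : ℝ) :
    (μX.prod μW).map (fun θ => (signal θ, output ι r θ)) =
      (μX.prod μW).withDensity fun p => ENNReal.ofReal (jointDensity B r p) := by
  refine Measure.ext_of_lintegral _ fun f hf => ?_
  have hd : Measurable fun p => ENNReal.ofReal (jointDensity B r p) :=
    (hB.measurable_jointDensity r).ennreal_ofReal
  have hs := measurable_signal_output ι r
  rw [lintegral_map hf hs, lintegral_withDensity_eq_lintegral_mul _ hd hf,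
    lintegral_prod (fun θ => f (signal θ, output ι r θ)) (hf.comp hs).aemeasurable, lintegral_prod _ (hd.mul hf).aemeasurable]
  refine lintegral_congr_ae ?_
  filter_upwards [hB.dualToH_eq] with x hx
  have h1 := hW.map_add_dualToH (r • B x)
  rw [dualToH_smul, hx] at h1
  have hfx : Measurable fun w => f (x, w) := hf.comp measurable_prodMk_left
  calc ∫⁻ w, f (signal (x, w), output ι r (x, w)) ∂μW
      = ∫⁻ w, f (x, w) ∂(μW.map fun w => ι (r • x) + w) := by
        rw [lintegral_map hfx (by fun_prop)]
        simp [signal, output]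
    _ = _ := by
        rw [h1, lintegral_withDensity_eq_lintegral_mul _ (by fun_prop) hfx]
        refine lintegral_congr fun w => ?_
        simp [jointDensity, norm_smul, mul_pow]

section ChangeOfVariables

variable {E : Type*} [NormedAddCommGroup E] [NormedSpace ℝ E]

theorem ae_signal_output (hW : IsAbstractWienerSpace ι μW) (hB : IsPairing ι μX B) (r : ℝ)
    {q : H × W → Prop} (h : ∀ᵐ p ∂(μX.prod μW), q p) :
    ∀ᵐ θ ∂(μX.prod μW), q (θ.1, output ι r θ) := by
  have h1 : ∀ᵐ p ∂((μX.prod μW).map fun θ => (signal θ, output ι r θ)), q p := by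
    rw [map_signal_output hW hB]
    exact (withDensity_absolutelyContinuous _ _).ae_le h
  exact ae_of_ae_map (measurable_signal_output ι r).aemeasurable h1

theorem ae_output (hW : IsAbstractWienerSpace ι μW) (hB : IsPairing ι μX B) (r : ℝ)
    {q : W → Prop} (h : ∀ᵐ w ∂μW, q w) : ∀ᵐ θ ∂(μX.prod μW), q (output ι r θ) :=
  ae_signal_output hW hB r (Measure.quasiMeasurePreserving_snd.ae h)

theorem integrable_signal_output_iff (hW : IsAbstractWienerSpace ι μW) (hB : IsPairing ι μX B)
    (r : ℝ) {g : H × W → E} (hg : AEStronglyMeasurable g (μX.prod μW)) :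
    Integrable (fun θ => g (θ.1, output ι r θ)) (μX.prod μW) ↔
      Integrable (fun p => jointDensity B r p • g p) (μX.prod μW) := by
  have hd : Measurable fun p => ENNReal.ofReal (jointDensity B r p) :=
    (hB.measurable_jointDensity r).ennreal_ofReal
  have h1 := integrable_map_measure (μ := μX.prod μW) (g := g)
    (f := fun θ => (signal θ, output ι r θ))
    (by rw [map_signal_output hW hB]; exact hg.mono_ac (withDensity_absolutelyContinuous _ _))
    (measurable_signal_output ι r).aemeasurable
  rw [map_signal_output hW hB, integrable_withDensity_iff_integrable_smul' hd (by simp)] at h1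
  simpa [ENNReal.toReal_ofReal (jointDensity_pos _ _ _).le, Function.comp_def, signal] using h1.symm

theorem integral_signal_output (hW : IsAbstractWienerSpace ι μW) (hB : IsPairing ι μX B)
    (r : ℝ) {g : H × W → E} (hg : AEStronglyMeasurable g (μX.prod μW)) :
    ∫ θ, g (θ.1, output ι r θ) ∂(μX.prod μW) =
      ∫ p, jointDensity B r p • g p ∂(μX.prod μW) := by
  have hd : Measurable fun p => ENNReal.ofReal (jointDensity B r p) :=
    (hB.measurable_jointDensity r).ennreal_ofReal
  have h1 := integral_map (μ := μX.prod μW) (f := g)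
    (φ := fun θ => (signal θ, output ι r θ)) (measurable_signal_output ι r).aemeasurable
    (by rw [map_signal_output hW hB]; exact hg.mono_ac (withDensity_absolutelyContinuous _ _))
  rw [map_signal_output hW hB, integral_withDensity_eq_integral_toReal_smul hd (by simp)] at h1
  simpa [ENNReal.toReal_ofReal (jointDensity_pos _ _ _).le, Function.comp_def, signal] using h1.symm

/-- Weighting by the joint density does not affect the integrals of functions of the signal. -/
theorem integrable_jointDensity_smul (hW : IsAbstractWienerSpace ι μW) (hB : IsPairing ι μX B)
    (r : ℝ) {g : H → E} (hg : Integrable g μX) :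
    Integrable (fun p : H × W => jointDensity B r p • g p.1) (μX.prod μW) :=
  (integrable_signal_output_iff hW hB r (g := fun p => g p.1) hg.1.comp_fst).1 (hg.comp_fst μW)

theorem integral_jointDensity_smul (hW : IsAbstractWienerSpace ι μW) (hB : IsPairing ι μX B)
    (r : ℝ) {g : H → E} (hg : AEStronglyMeasurable g μX) :
    ∫ p : H × W, jointDensity B r p • g p.1 ∂(μX.prod μW) = ∫ x, g x ∂μX := by
  rw [← integral_signal_output hW hB r (g := fun p => g p.1) hg.comp_fst, integral_fun_fst]
  simp

end ChangeOfVariables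

theorem integrable_jointDensity (hW : IsAbstractWienerSpace ι μW) (hB : IsPairing ι μX B)
    (r : ℝ) : Integrable (jointDensity B r) (μX.prod μW) := by
  simpa using integrable_jointDensity_smul hW hB r (integrable_const (1 : ℝ))

theorem ae_integrable_jointDensity (hW : IsAbstractWienerSpace ι μW) (hB : IsPairing ι μX B)
    (r : ℝ) : ∀ᵐ w ∂μW, Integrable (fun x => jointDensity B r (x, w)) μX :=
  (integrable_jointDensity hW hB r).prod_left_ae

theorem integrable_outputDensity (hW : IsAbstractWienerSpace ι μW) (hB : IsPairing ι μX B)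
    (r : ℝ) : Integrable (outputDensity μX B r) μW :=
  (integrable_jointDensity hW hB r).integral_prod_right

theorem integral_outputDensity (hW : IsAbstractWienerSpace ι μW) (hB : IsPairing ι μX B)
    (r : ℝ) : ∫ w, outputDensity μX B r w ∂μW = 1 := by
  have h1 := integral_jointDensity_smul hW hB r (g := fun _ => (1 : ℝ)) (by fun_prop)
  rw [integral_prod_symm _ (by simpa using integrable_jointDensity hW hB r)] at h1
  simpa [outputDensity] using h1

theorem ae_outputDensity_pos (hW : IsAbstractWienerSpace ι μW) (hB : IsPairing ι μX B)
    (r : ℝ) : ∀ᵐ w ∂μW, 0 < outputDensity μX B r w := by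
  filter_upwards [ae_integrable_jointDensity hW hB r] with w hw
  refine (integral_pos_iff_support_of_nonneg (fun x => (jointDensity_pos _ _ _).le) hw).2 ?_
  have : Function.support (fun x => jointDensity B r (x, w)) = Set.univ :=
    Set.eq_univ_of_forall fun x => (jointDensity_pos _ _ _).ne'
  simp [this]

theorem outputLaw_eq_withDensity (hW : IsAbstractWienerSpace ι μW) (hB : IsPairing ι μX B)
    (r : ℝ) : outputLaw ι μX μW r =
      μW.withDensity fun w => ENNReal.ofReal (outputDensity μX B r w) := by
  refine Measure.ext_of_lintegral _ fun f hf => ?_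
  have hd : Measurable fun p => ENNReal.ofReal (jointDensity B r p) :=
    (hB.measurable_jointDensity r).ennreal_ofReal
  have hf' : Measurable fun p : H × W => f p.2 := hf.comp measurable_snd
  have h1 := lintegral_map (μ := μX.prod μW) hf' (measurable_signal_output ι r)
  rw [map_signal_output hW hB, lintegral_withDensity_eq_lintegral_mul _ hd hf'] at h1
  rw [outputLaw, lintegral_map hf (measurable_output ι r), ← h1,
    lintegral_prod_symm _ (hd.mul hf').aemeasurable,
    lintegral_withDensity_eq_lintegral_mul _
      (hB.stronglyMeasurable_outputDensity r).measurable.ennreal_ofReal hf]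
  refine lintegral_congr_ae ?_
  filter_upwards [ae_integrable_jointDensity hW hB r] with w hw
  simp only [Pi.mul_apply]
  rw [lintegral_mul_const (f := fun x => ENNReal.ofReal (jointDensity B r (x, w))) _
    (hd.comp measurable_prodMk_right), outputDensity,
    ofReal_integral_eq_lintegral_ofReal hw (ae_of_all _ fun x => (jointDensity_pos _ _ _).le)]

theorem outputLaw_absolutelyContinuous (hW : IsAbstractWienerSpace ι μW)
    (hB : IsPairing ι μX B) (r : ℝ) : outputLaw ι μX μW r ≪ μW := by
  rw [outputLaw_eq_withDensity hW hB]
  exact withDensity_absolutelyContinuous _ _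

theorem likelihoodRatio_ae_eq (hW : IsAbstractWienerSpace ι μW) (hB : IsPairing ι μX B)
    (r : ℝ) : likelihoodRatio ι μX μW r =ᵐ[μW] outputDensity μX B r := by
  have h := Measure.rnDeriv_withDensity μW
    (hB.stronglyMeasurable_outputDensity r).measurable.ennreal_ofReal
  rw [← outputLaw_eq_withDensity hW hB] at h
  filter_upwards [h] with w hw
  rw [likelihoodRatio, hw, ENNReal.toReal_ofReal (outputDensity_nonneg _ _ _ _)]

section OutputChangeOfVariables

variable {E : Type*} [NormedAddCommGroup E] [NormedSpace ℝ E]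

theorem integrable_output_iff (hW : IsAbstractWienerSpace ι μW) (hB : IsPairing ι μX B)
    (r : ℝ) {g : W → E} (hg : AEStronglyMeasurable g μW) :
    Integrable (fun θ => g (output ι r θ)) (μX.prod μW) ↔
      Integrable (fun w => outputDensity μX B r w • g w) μW := by
  have hd : Measurable fun w => ENNReal.ofReal (outputDensity μX B r w) :=
    (hB.stronglyMeasurable_outputDensity r).measurable.ennreal_ofReal
  have h1 := integrable_map_measure (μ := μX.prod μW) (g := g) (f := output ι r)
    (hg.mono_ac (outputLaw_absolutelyContinuous hW hB r)) (measurable_output ι r).aemeasurable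
  rw [← outputLaw, outputLaw_eq_withDensity hW hB,
    integrable_withDensity_iff_integrable_smul' hd (by simp)] at h1
  simpa [ENNReal.toReal_ofReal (outputDensity_nonneg _ _ _ _), Function.comp_def] using h1.symm

theorem integral_output (hW : IsAbstractWienerSpace ι μW) (hB : IsPairing ι μX B)
    (r : ℝ) {g : W → E} (hg : AEStronglyMeasurable g μW) :
    ∫ θ, g (output ι r θ) ∂(μX.prod μW) = ∫ w, outputDensity μX B r w • g w ∂μW := by
  have hd : Measurable fun w => ENNReal.ofReal (outputDensity μX B r w) :=
    (hB.stronglyMeasurable_outputDensity r).measurable.ennreal_ofReal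
  have h1 := integral_map (μ := μX.prod μW) (f := g) (measurable_output ι r).aemeasurable
    (hg.mono_ac (outputLaw_absolutelyContinuous hW hB r))
  rw [← outputLaw, outputLaw_eq_withDensity hW hB,
    integral_withDensity_eq_integral_toReal_smul hd (by simp)] at h1
  simpa [ENNReal.toReal_ofReal (outputDensity_nonneg _ _ _ _), Function.comp_def] using h1.symm

end OutputChangeOfVariables

/-! ### The mutual information in terms of the output density -/

theorem integrable_pairing (hW : IsAbstractWienerSpace ι μW) (hB : IsPairing ι μX B)
    (hsq : Integrable (fun x : H => ‖x‖ ^ 2) μX) :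
    Integrable (fun p : H × W => B p.1 p.2) (μX.prod μW) := by
  refine MemLp.integrable (q := 2) (by norm_num) ?_
  rw [memLp_two_iff_integrable_sq hB.measurable.aestronglyMeasurable,
    integrable_prod_iff (hB.measurable.pow_const 2).aestronglyMeasurable]
  refine ⟨ae_of_all _ fun x => (hW.memLp_two (B x)).integrable_sq, hsq.congr ?_⟩
  filter_upwards [hB.dualToH_eq] with x hx
  simp [hW.integral_sq, hx]

theorem integral_pairing (hW : IsAbstractWienerSpace ι μW) (hB : IsPairing ι μX B)
    (hsq : Integrable (fun x : H => ‖x‖ ^ 2) μX) :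
    ∫ p : H × W, B p.1 p.2 ∂(μX.prod μW) = 0 := by
  rw [integral_prod _ (integrable_pairing hW hB hsq)]
  simp [hW.integral_eq_zero]

theorem log_jointDensity_signal_output (hB : IsPairing ι μX B) (r : ℝ) :
    (fun θ : H × W => Real.log (jointDensity B r (θ.1, output ι r θ))) =ᵐ[μX.prod μW]
      fun θ => r * B θ.1 θ.2 + r ^ 2 / 2 * ‖θ.1‖ ^ 2 := by
  filter_upwards [Measure.quasiMeasurePreserving_fst.ae hB.ae_apply_eq_inner] with θ hθ
  simp only [log_jointDensity, output, map_add, map_smul, hθ, real_inner_self_eq_norm_sq,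
    smul_eq_mul]
  ring

theorem integrable_log_jointDensity (hW : IsAbstractWienerSpace ι μW) (hB : IsPairing ι μX B)
    (hsq : Integrable (fun x : H => ‖x‖ ^ 2) μX) (r : ℝ) :
    Integrable (fun θ : H × W => Real.log (jointDensity B r (θ.1, output ι r θ)))
      (μX.prod μW) :=
  (((integrable_pairing hW hB hsq).const_mul r).add
    ((hsq.comp_fst μW).const_mul (r ^ 2 / 2))).congr (log_jointDensity_signal_output hB r).symm

theorem integral_log_jointDensity (hW : IsAbstractWienerSpace ι μW) (hB : IsPairing ι μX B)
    (hsq : Integrable (fun x : H => ‖x‖ ^ 2) μX) (r : ℝ) :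
    ∫ θ : H × W, Real.log (jointDensity B r (θ.1, output ι r θ)) ∂(μX.prod μW) =
      r ^ 2 / 2 * ∫ x, ‖x‖ ^ 2 ∂μX := by
  rw [integral_congr_ae (log_jointDensity_signal_output hB r),
    integral_add ((integrable_pairing hW hB hsq).const_mul r)
      ((hsq.comp_fst μW).const_mul (r ^ 2 / 2)), integral_const_mul, integral_const_mul,
    integral_pairing hW hB hsq, integral_fun_fst (fun x : H => ‖x‖ ^ 2)]
  simp

/-- The negative part of `t log t` is bounded. -/
theorem abs_mul_min_log_le {t : ℝ} (ht : 0 < t) : |t * min (Real.log t) 0| ≤ 1 := by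
  rcases le_total (Real.log t) 0 with h | h
  · have h1 := Real.one_sub_inv_le_log_of_pos ht
    have h2 : t * (1 - t⁻¹) ≤ t * Real.log t := mul_le_mul_of_nonneg_left h1 ht.le
    rw [mul_sub, mul_inv_cancel₀ ht.ne'] at h2
    rw [min_eq_left h, abs_of_nonpos (mul_nonpos_of_nonneg_of_nonpos ht.le h)]
    linarith
  · simp [min_eq_right h]

/-- The negative part of the logarithm of a density is integrable under the law with that
density; this applies both to the law of the output, and to the joint law with respect to the
product of its marginals. As the logarithm of the joint density is integrable, both bounds on the
logarithm of the output density follow. -/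
theorem integrable_log_outputDensity (hW : IsAbstractWienerSpace ι μW) (hB : IsPairing ι μX B)
    (hsq : Integrable (fun x : H => ‖x‖ ^ 2) μX) (r : ℝ) :
    Integrable (fun θ : H × W => Real.log (outputDensity μX B r (output ι r θ)))
      (μX.prod μW) := by
  have hm := (hB.stronglyMeasurable_outputDensity r).measurable
  have hmJ := hB.measurable_jointDensity r
  have h1 : Integrable (fun θ : H × W => min (Real.log (outputDensity μX B r (output ι r θ))) 0)
      (μX.prod μW) := by
    rw [integrable_output_iff hW hB r
      (g := fun w => min (Real.log (outputDensity μX B r w)) 0)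
      (hm.log.min measurable_const).aestronglyMeasurable]
    refine Integrable.of_bound (C := 1)
      (hm.mul (hm.log.min measurable_const)).aestronglyMeasurable ?_
    filter_upwards [ae_outputDensity_pos hW hB r] with w hw
    exact abs_mul_min_log_le hw
  have hq : Measurable fun p : H × W =>
      min (Real.log (jointDensity B r p / outputDensity μX B r p.2)) 0 :=
    (hmJ.div (hm.comp measurable_snd)).log.min measurable_const
  have h2 : Integrable (fun θ : H × W =>
      min (Real.log (jointDensity B r (θ.1, output ι r θ) /
        outputDensity μX B r (output ι r θ))) 0) (μX.prod μW) := by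
    rw [integrable_signal_output_iff hW hB r (g := fun p =>
      min (Real.log (jointDensity B r p / outputDensity μX B r p.2)) 0) hq.aestronglyMeasurable]
    refine Integrable.mono' ((integrable_outputDensity hW hB r).comp_snd μX)
      (hmJ.mul hq).aestronglyMeasurable ?_
    filter_upwards [Measure.quasiMeasurePreserving_snd.ae (ae_outputDensity_pos hW hB r)]
      with p hp
    have h3 := abs_mul_min_log_le (div_pos (jointDensity_pos B r p) hp)
    rw [Real.norm_eq_abs, smul_eq_mul]
    calc |jointDensity B r p *
          min (Real.log (jointDensity B r p / outputDensity μX B r p.2)) 0|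
        = outputDensity μX B r p.2 * |jointDensity B r p / outputDensity μX B r p.2 *
          min (Real.log (jointDensity B r p / outputDensity μX B r p.2)) 0| := by
          rw [← abs_of_pos hp, ← abs_mul, abs_of_pos hp, ← mul_assoc, mul_div_cancel₀ _ hp.ne']
      _ ≤ outputDensity μX B r p.2 * 1 := by gcongr
      _ = _ := mul_one _
  refine integrable_of_le_of_le (Measurable.aestronglyMeasurable
    (Real.measurable_log.comp (hm.comp (measurable_output ι r))))
    (ae_of_all _ fun θ => min_le_left _ 0) ?_ h1
    ((integrable_log_jointDensity hW hB hsq r).sub h2)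
  filter_upwards [ae_output hW hB r (ae_outputDensity_pos hW hB r)] with θ hθ
  have h4 := min_le_left (Real.log (jointDensity B r (θ.1, output ι r θ) /
        outputDensity μX B r (output ι r θ))) 0
  rw [Real.log_div (jointDensity_pos _ _ _).ne' hθ.ne'] at h4
  simp only [Pi.sub_apply]
  rw [Real.log_div (jointDensity_pos _ _ _).ne' hθ.ne']
  linarith

theorem map_signal_prod_map_output (hW : IsAbstractWienerSpace ι μW) (hB : IsPairing ι μX B)
    (r : ℝ) : ((μX.prod μW).map signal).prod ((μX.prod μW).map (output ι r)) =
      (μX.prod μW).withDensity fun p => ENNReal.ofReal (outputDensity μX B r p.2) := by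
  have h1 : (μX.prod μW).map (signal : H × W → H) = μX := measurePreserving_fst.map_eq
  rw [h1, ← outputLaw, outputLaw_eq_withDensity hW hB, prod_withDensity_right
    (hB.stronglyMeasurable_outputDensity r).measurable.ennreal_ofReal]

theorem map_signal_output_eq_withDensity (hW : IsAbstractWienerSpace ι μW)
    (hB : IsPairing ι μX B) (r : ℝ) :
    (μX.prod μW).map (fun θ => (signal θ, output ι r θ)) =
      (((μX.prod μW).map signal).prod ((μX.prod μW).map (output ι r))).withDensity
        fun p => ENNReal.ofReal (jointDensity B r p / outputDensity μX B r p.2) := by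
  have hm := (hB.stronglyMeasurable_outputDensity r).measurable
  have hmJ := hB.measurable_jointDensity r
  rw [map_signal_output hW hB, map_signal_prod_map_output hW hB, ← withDensity_mul _
    (by fun_prop) (by fun_prop)]
  refine withDensity_congr_ae ?_
  filter_upwards [Measure.quasiMeasurePreserving_snd.ae (ae_outputDensity_pos hW hB r)] with p hp
  rw [Pi.mul_apply, ← ENNReal.ofReal_mul hp.le, mul_div_cancel₀ _ hp.ne']

theorem map_signal_output_absolutelyContinuous (hW : IsAbstractWienerSpace ι μW)
    (hB : IsPairing ι μX B) (r : ℝ) :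
    (μX.prod μW).map (fun θ => (signal θ, output ι r θ)) ≪
      ((μX.prod μW).map signal).prod ((μX.prod μW).map (output ι r)) := by
  rw [map_signal_output_eq_withDensity hW hB]
  exact withDensity_absolutelyContinuous _ _

theorem llr_signal_output (hW : IsAbstractWienerSpace ι μW) (hB : IsPairing ι μX B) (r : ℝ) :
    (fun θ : H × W => llr ((μX.prod μW).map (fun θ => (signal θ, output ι r θ)))
        (((μX.prod μW).map signal).prod ((μX.prod μW).map (output ι r)))
        (signal θ, output ι r θ)) =ᵐ[μX.prod μW]
      fun θ => Real.log (jointDensity B r (θ.1, output ι r θ)) -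
        Real.log (outputDensity μX B r (output ι r θ)) := by
  have hm := (hB.stronglyMeasurable_outputDensity r).measurable
  have hmJ := hB.measurable_jointDensity r
  have : IsProbabilityMeasure ((μX.prod μW).map (output ι r)) :=
    Measure.isProbabilityMeasure_map (measurable_output ι r).aemeasurable
  have : IsProbabilityMeasure ((μX.prod μW).map (signal : H × W → H)) :=
    Measure.isProbabilityMeasure_map measurable_fst.aemeasurable
  have h1 := Measure.rnDeriv_withDensity
    (((μX.prod μW).map signal).prod ((μX.prod μW).map (output ι r)))
    (f := fun p => ENNReal.ofReal (jointDensity B r p / outputDensity μX B r p.2)) (by fun_prop)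
  rw [← map_signal_output_eq_withDensity hW hB] at h1
  have h2 := ae_of_ae_map (measurable_signal_output ι r).aemeasurable
    ((map_signal_output_absolutelyContinuous hW hB r).ae_le h1)
  filter_upwards [h2, ae_output hW hB r (ae_outputDensity_pos hW hB r)] with θ hθ hpos
  simp only [llr_def]
  rw [hθ, ENNReal.toReal_ofReal (div_nonneg (jointDensity_pos _ _ _).le hpos.le),
    Real.log_div (jointDensity_pos _ _ _).ne' hpos.ne', signal]

theorem integrable_llr_signal_output (hW : IsAbstractWienerSpace ι μW) (hB : IsPairing ι μX B)
    (hsq : Integrable (fun x : H => ‖x‖ ^ 2) μX) (r : ℝ) :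
    Integrable (llr ((μX.prod μW).map (fun θ => (signal θ, output ι r θ)))
        (((μX.prod μW).map signal).prod ((μX.prod μW).map (output ι r))))
      ((μX.prod μW).map (fun θ => (signal θ, output ι r θ))) := by
  rw [integrable_map_measure (measurable_llr _ _).aestronglyMeasurable
    (measurable_signal_output ι r).aemeasurable]
  exact ((integrable_log_jointDensity hW hB hsq r).sub
    (integrable_log_outputDensity hW hB hsq r)).congr (llr_signal_output hW hB r).symm

theorem channelInfo_eq (hW : IsAbstractWienerSpace ι μW) (hB : IsPairing ι μX B)
    (hsq : Integrable (fun x : H => ‖x‖ ^ 2) μX) (r : ℝ) :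
    channelInfo ι μX μW r = r ^ 2 / 2 * ∫ x, ‖x‖ ^ 2 ∂μX -
      ∫ θ, Real.log (outputDensity μX B r (output ι r θ)) ∂(μX.prod μW) := by
  rw [channelInfo, mutualInfo, integral_map (measurable_signal_output ι r).aemeasurable
    (measurable_llr _ _).aestronglyMeasurable, integral_congr_ae (llr_signal_output hW hB r),
    integral_sub (integrable_log_jointDensity hW hB hsq r)
      (integrable_log_outputDensity hW hB hsq r), integral_log_jointDensity hW hB hsq]

/-! ### The posterior mean and the conditional expectation -/

theorem integrable_id_of_sq (hsq : Integrable (fun x : H => ‖x‖ ^ 2) μX) :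
    Integrable (fun x : H => x) μX :=
  ((memLp_two_iff_integrable_sq_norm aestronglyMeasurable_id).2 hsq).integrable (by norm_num)

theorem ae_integrable_weightedMean (hW : IsAbstractWienerSpace ι μW) (hB : IsPairing ι μX B)
    (hsq : Integrable (fun x : H => ‖x‖ ^ 2) μX) (r : ℝ) :
    ∀ᵐ w ∂μW, Integrable (fun x => jointDensity B r (x, w) • x) μX :=
  (integrable_jointDensity_smul hW hB r (integrable_id_of_sq hsq)).prod_left_ae

theorem ae_integrable_weightedEnergy (hW : IsAbstractWienerSpace ι μW) (hB : IsPairing ι μX B)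
    (hsq : Integrable (fun x : H => ‖x‖ ^ 2) μX) (r : ℝ) :
    ∀ᵐ w ∂μW, Integrable (fun x => jointDensity B r (x, w) * ‖x‖ ^ 2) μX :=
  (integrable_jointDensity_smul hW hB r hsq).prod_left_ae

theorem integrable_weightedEnergy (hW : IsAbstractWienerSpace ι μW) (hB : IsPairing ι μX B)
    (hsq : Integrable (fun x : H => ‖x‖ ^ 2) μX) (r : ℝ) :
    Integrable (weightedEnergy μX B r) μW :=
  (integrable_jointDensity_smul hW hB r hsq).integral_prod_right

theorem outputDensity_smul_posteriorMean {r : ℝ} {w : W} (h : 0 < outputDensity μX B r w) :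
    outputDensity μX B r w • posteriorMean μX B r w = weightedMean μX B r w :=
  smul_inv_smul₀ h.ne' _

/-- The posterior energy of the mean is at most the mean posterior energy. -/
theorem outputDensity_mul_norm_sq_le (hW : IsAbstractWienerSpace ι μW) (hB : IsPairing ι μX B)
    (hsq : Integrable (fun x : H => ‖x‖ ^ 2) μX) (r : ℝ) :
    ∀ᵐ w ∂μW, outputDensity μX B r w * ‖posteriorMean μX B r w‖ ^ 2 ≤
      weightedEnergy μX B r w := by
  filter_upwards [ae_integrable_jointDensity hW hB r, ae_integrable_weightedMean hW hB hsq r,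
    ae_integrable_weightedEnergy hW hB hsq r, ae_outputDensity_pos hW hB r] with w h0 h1 h2 hpos
  set a := posteriorMean μX B r w with ha
  have hN : ∫ x, jointDensity B r (x, w) * inner ℝ x a ∂μX =
      outputDensity μX B r w * ‖a‖ ^ 2 := by
    have : ∫ x, inner ℝ a (jointDensity B r (x, w) • x) ∂μX = inner ℝ a (weightedMean μX B r w) :=
      integral_inner h1 a
    rw [← outputDensity_smul_posteriorMean hpos, ← ha, inner_smul_right,
      real_inner_self_eq_norm_sq] at this
    rw [← this]
    simp [inner_smul_right, real_inner_comm]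
  have hNi : Integrable (fun x => jointDensity B r (x, w) * inner ℝ x a) μX := by
    simpa [inner_smul_right, real_inner_comm] using h1.const_inner (𝕜 := ℝ) a
  have hnn : 0 ≤ ∫ x, jointDensity B r (x, w) * ‖x - a‖ ^ 2 ∂μX :=
    integral_nonneg fun x => mul_nonneg (jointDensity_pos _ _ _).le (sq_nonneg _)
  have hexp : ∫ x, jointDensity B r (x, w) * ‖x - a‖ ^ 2 ∂μX = weightedEnergy μX B r w -
      2 * (outputDensity μX B r w * ‖a‖ ^ 2) + outputDensity μX B r w * ‖a‖ ^ 2 := by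
    have e1 := integral_add (h2.sub (hNi.const_mul 2)) (h0.mul_const (‖a‖ ^ 2))
    have e2 := integral_sub h2 (hNi.const_mul 2)
    rw [integral_const_mul, hN] at e2
    rw [integral_mul_const] at e1
    simp only [Pi.sub_apply] at e1
    rw [weightedEnergy, ← e2, outputDensity, ← e1]
    refine integral_congr_ae (ae_of_all _ fun x => ?_)
    simp only [norm_sub_sq_real]
    ring
  linarith

theorem integrable_outputDensity_mul_norm_sq (hW : IsAbstractWienerSpace ι μW)
    (hB : IsPairing ι μX B) (hsq : Integrable (fun x : H => ‖x‖ ^ 2) μX) (r : ℝ) :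
    Integrable (fun w => outputDensity μX B r w * ‖posteriorMean μX B r w‖ ^ 2) μW := by
  refine (integrable_weightedEnergy hW hB hsq r).mono'
    ((hB.stronglyMeasurable_outputDensity r).mul
      ((hB.stronglyMeasurable_posteriorMean r).norm.pow 2)).aestronglyMeasurable ?_
  filter_upwards [outputDensity_mul_norm_sq_le hW hB hsq r] with w hw
  rwa [Real.norm_eq_abs, abs_of_nonneg (mul_nonneg (outputDensity_nonneg _ _ _ _) (sq_nonneg _))]

theorem integrable_norm_sq_posteriorMean (hW : IsAbstractWienerSpace ι μW)
    (hB : IsPairing ι μX B) (hsq : Integrable (fun x : H => ‖x‖ ^ 2) μX) (r : ℝ) :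
    Integrable (fun θ => ‖posteriorMean μX B r (output ι r θ)‖ ^ 2) (μX.prod μW) :=
  (integrable_output_iff hW hB r (g := fun w => ‖posteriorMean μX B r w‖ ^ 2)
    ((hB.stronglyMeasurable_posteriorMean r).norm.pow 2).aestronglyMeasurable).2
      (integrable_outputDensity_mul_norm_sq hW hB hsq r)

theorem integral_norm_sq_posteriorMean (hW : IsAbstractWienerSpace ι μW)
    (hB : IsPairing ι μX B) (r : ℝ) :
    ∫ θ, ‖posteriorMean μX B r (output ι r θ)‖ ^ 2 ∂(μX.prod μW) =
      ∫ w, outputDensity μX B r w * ‖posteriorMean μX B r w‖ ^ 2 ∂μW :=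
  integral_output hW hB r (g := fun w => ‖posteriorMean μX B r w‖ ^ 2)
    ((hB.stronglyMeasurable_posteriorMean r).norm.pow 2).aestronglyMeasurable

theorem stronglyMeasurable_posteriorMean_output (hB : IsPairing ι μX B) (r : ℝ) :
    StronglyMeasurable fun θ : H × W => posteriorMean μX B r (output ι r θ) :=
  (hB.stronglyMeasurable_posteriorMean r).comp_measurable (measurable_output ι r)

theorem integrable_inner_posteriorMean (hW : IsAbstractWienerSpace ι μW)
    (hB : IsPairing ι μX B) (hsq : Integrable (fun x : H => ‖x‖ ^ 2) μX) (r : ℝ) :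
    Integrable (fun θ : H × W => (inner ℝ θ.1 (posteriorMean μX B r (output ι r θ)) : ℝ))
      (μX.prod μW) := by
  refine (((hsq.comp_fst μW).add (integrable_norm_sq_posteriorMean hW hB hsq r))).mono'
    (measurable_fst.stronglyMeasurable.inner (𝕜 := ℝ)
      (stronglyMeasurable_posteriorMean_output hB r)).aestronglyMeasurable
    (ae_of_all _ fun θ => (norm_inner_le_norm _ _).trans ?_)
  simp only [Pi.add_apply]
  nlinarith [sq_nonneg (‖θ.1‖ - ‖posteriorMean μX B r (output ι r θ)‖),
    sq_nonneg ‖θ.1‖, sq_nonneg ‖posteriorMean μX B r (output ι r θ)‖]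

theorem integral_inner_posteriorMean (hW : IsAbstractWienerSpace ι μW)
    (hB : IsPairing ι μX B) (hsq : Integrable (fun x : H => ‖x‖ ^ 2) μX) (r : ℝ) :
    ∫ θ : H × W, (inner ℝ θ.1 (posteriorMean μX B r (output ι r θ)) : ℝ) ∂(μX.prod μW) =
      ∫ θ, ‖posteriorMean μX B r (output ι r θ)‖ ^ 2 ∂(μX.prod μW) := by
  have hm : StronglyMeasurable fun p : H × W => (inner ℝ p.1 (posteriorMean μX B r p.2) : ℝ) :=
    measurable_fst.stronglyMeasurable.inner (𝕜 := ℝ)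
      ((hB.stronglyMeasurable_posteriorMean r).comp_measurable measurable_snd)
  have hi := integrable_inner_posteriorMean hW hB hsq r
  rw [integrable_signal_output_iff hW hB r
    (g := fun p : H × W => (inner ℝ p.1 (posteriorMean μX B r p.2) : ℝ))
    hm.aestronglyMeasurable] at hi
  rw [integral_signal_output hW hB r
    (g := fun p : H × W => (inner ℝ p.1 (posteriorMean μX B r p.2) : ℝ))
    hm.aestronglyMeasurable, integral_prod_symm _ hi, integral_norm_sq_posteriorMean hW hB]
  refine integral_congr_ae ?_
  filter_upwards [ae_integrable_weightedMean hW hB hsq r, ae_outputDensity_pos hW hB r]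
    with w h1 hpos
  have : ∫ x, inner ℝ (posteriorMean μX B r w) (jointDensity B r (x, w) • x) ∂μX =
      inner ℝ (posteriorMean μX B r w) (weightedMean μX B r w) := integral_inner h1 _
  rw [← outputDensity_smul_posteriorMean hpos, inner_smul_right,
    real_inner_self_eq_norm_sq] at this
  rw [← this]
  simp [inner_smul_right, real_inner_comm]

/-- **Bayes' formula**: the conditional expectation of the signal given the output is the
posterior mean. -/
theorem estimate_ae_eq (hW : IsAbstractWienerSpace ι μW)
    (hB : IsPairing ι μX B) (hsq : Integrable (fun x : H => ‖x‖ ^ 2) μX) (r : ℝ) :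
    estimate ι μX μW r =ᵐ[μX.prod μW] fun θ => posteriorMean μX B r (output ι r θ) := by
  have hle := (measurable_output (H := H) ι r).comap_le
  have hid := integrable_id_of_sq hsq
  have hmem : MemLp (fun θ => posteriorMean μX B r (output ι r θ)) 2 (μX.prod μW) :=
    (memLp_two_iff_integrable_sq_norm
      (stronglyMeasurable_posteriorMean_output hB r).aestronglyMeasurable).2
      (integrable_norm_sq_posteriorMean hW hB hsq r)
  have hint := hmem.integrable (by norm_num)
  refine (ae_eq_condExp_of_forall_setIntegral_eq hle (hid.comp_fst μW)
    (fun s _ _ => hint.integrableOn) ?_ ?_).symm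
  · rintro s ⟨A, hA, rfl⟩ -
    have hs : MeasurableSet (output ι r ⁻¹' A : Set (H × W)) := measurable_output ι r hA
    have h1 : Integrable (fun p : H × W => jointDensity B r p • A.indicator (fun _ => p.1) p.2)
        (μX.prod μW) := by
      have := (integrable_jointDensity_smul hW hB r hid).indicator
        (measurable_snd hA : MeasurableSet (Prod.snd ⁻¹' A : Set (H × W)))
      refine this.congr (ae_of_all _ fun p => ?_)
      by_cases hp : p.2 ∈ A <;> simp [hp, Set.indicator]
    rw [← integral_indicator hs, ← integral_indicator hs]
    have e1 : ∀ θ : H × W, (output ι r ⁻¹' A : Set (H × W)).indicator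
        (fun θ => posteriorMean μX B r (output ι r θ)) θ =
        A.indicator (posteriorMean μX B r) (output ι r θ) := fun _ => rfl
    have e2 : ∀ θ : H × W, (output ι r ⁻¹' A : Set (H × W)).indicator (fun θ => θ.1) θ =
        A.indicator (fun _ => θ.1) (output ι r θ) := fun _ => rfl
    simp only [e1, e2]
    have hm2 : StronglyMeasurable fun p : H × W => A.indicator (fun _ => p.1) p.2 :=
      (measurable_fst.indicator (f := (Prod.fst : H × W → H))
        (measurable_snd hA : MeasurableSet (Prod.snd ⁻¹' A : Set (H × W)))).stronglyMeasurable
    rw [integral_output hW hB r (g := A.indicator (posteriorMean μX B r))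
        ((hB.stronglyMeasurable_posteriorMean r).indicator hA).aestronglyMeasurable,
      integral_signal_output hW hB r (g := fun p : H × W => A.indicator (fun _ => p.1) p.2)
        hm2.aestronglyMeasurable, integral_prod_symm _ h1]
    refine integral_congr_ae ?_
    filter_upwards [ae_outputDensity_pos hW hB r] with w hpos
    by_cases hw : w ∈ A
    · simpa [hw, weightedMean] using outputDensity_smul_posteriorMean (μX := μX) hpos
    · simp [hw]
  · exact ((hB.stronglyMeasurable_posteriorMean r).comp_measurable
      (comap_measurable (output ι r))).aestronglyMeasurable

/-- The mean square error is the difference of the energies of the signal and of its estimate. -/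
theorem integral_norm_sub_posteriorMean_sq (hW : IsAbstractWienerSpace ι μW)
    (hB : IsPairing ι μX B) (hsq : Integrable (fun x : H => ‖x‖ ^ 2) μX) (r : ℝ) :
    Integrable (fun θ : H × W => ‖θ.1 - posteriorMean μX B r (output ι r θ)‖ ^ 2)
      (μX.prod μW) ∧
    ∫ θ : H × W, ‖θ.1 - posteriorMean μX B r (output ι r θ)‖ ^ 2 ∂(μX.prod μW) =
      ∫ θ : H × W, (‖θ.1‖ ^ 2 - ‖posteriorMean μX B r (output ι r θ)‖ ^ 2) ∂(μX.prod μW) := by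
  have h1 := hsq.comp_fst μW
  have h2 := integrable_norm_sq_posteriorMean hW hB hsq r
  have h3 := (integrable_inner_posteriorMean hW hB hsq r).const_mul 2
  simp only [norm_sub_sq_real]
  refine ⟨(h1.sub h3).add h2, ?_⟩
  have e1 := integral_add (h1.sub h3) h2
  have e2 := integral_sub h1 h3
  have e3 := integral_sub h1 h2
  simp only [Pi.sub_apply] at e1
  rw [e1, e2, e3, integral_const_mul, integral_inner_posteriorMean hW hB hsq]
  ring

/-! ### The relative entropy of the output has a subgradient -/

/-- The relative entropy of the law of the output with respect to `μW`. -/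
def outputEntropy (ι : H →L[ℝ] W) (μX : Measure H) (μW : Measure W) (B : H → W →L[ℝ] ℝ)
    (r : ℝ) : ℝ :=
  ∫ θ, Real.log (outputDensity μX B r (output ι r θ)) ∂(μX.prod μW)

/-- The energy `E |E(x | Y)|²` of the estimate. -/
def estimateEnergy (ι : H →L[ℝ] W) (μX : Measure H) (μW : Measure W) (B : H → W →L[ℝ] ℝ)
    (r : ℝ) : ℝ :=
  ∫ θ, ‖posteriorMean μX B r (output ι r θ)‖ ^ 2 ∂(μX.prod μW)

/-- Along the Cameron–Martin directions, the logarithm of the output density lies above its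
tangents: shifting `w` by `h` multiplies the posterior weight of `x` by `exp (r (x, h))`, and
Jensen's inequality applies to the posterior law. -/
theorem log_outputDensity_add_le (hB : IsPairing ι μX B) (r : ℝ) {w : W} (h : H)
    (h0 : Integrable (fun x => jointDensity B r (x, w)) μX)
    (h1 : Integrable (fun x => jointDensity B r (x, w) • x) μX)
    (h2 : Integrable (fun x => jointDensity B r (x, w + ι h)) μX)
    (hpos : 0 < outputDensity μX B r w) :
    Real.log (outputDensity μX B r w) + r * inner ℝ h (posteriorMean μX B r w) ≤
      Real.log (outputDensity μX B r (w + ι h)) := by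
  set a := r * inner ℝ h (posteriorMean μX B r w) with ha
  have h1' : Integrable (fun x => jointDensity B r (x, w) * inner ℝ h x) μX := by
    simpa [inner_smul_right] using h1.const_inner (𝕜 := ℝ) h
  have hmean : r * ∫ x, jointDensity B r (x, w) * inner ℝ h x ∂μX =
      outputDensity μX B r w * a := by
    have : ∫ x, inner ℝ h (jointDensity B r (x, w) • x) ∂μX = inner ℝ h (weightedMean μX B r w) :=
      integral_inner h1 h
    rw [← outputDensity_smul_posteriorMean hpos] at this
    simp only [inner_smul_right] at this
    rw [this, ha]
    ring
  have hlow : Real.exp a * outputDensity μX B r w ≤ outputDensity μX B r (w + ι h) := by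
    have e1 := integral_add (h0.mul_const (1 - a)) (h1'.const_mul r)
    rw [integral_mul_const, integral_const_mul, hmean, ← outputDensity] at e1
    have e2 : ∫ x, Real.exp a * (jointDensity B r (x, w) * (1 - a) +
        r * (jointDensity B r (x, w) * inner ℝ h x)) ∂μX =
        Real.exp a * outputDensity μX B r w := by
      rw [integral_const_mul, e1]
      ring
    rw [← e2]
    refine integral_mono_ae (((h0.mul_const (1 - a)).add (h1'.const_mul r)).const_mul _) h2 ?_
    filter_upwards [hB.ae_apply_eq_inner] with x hx
    have hshift : jointDensity B r (x, w + ι h) =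
        jointDensity B r (x, w) * Real.exp (r * inner ℝ h x) := by
      simp only [jointDensity, map_add, hx, ← Real.exp_add, real_inner_comm h x]
      ring_nf
    have hconv : Real.exp a * (1 - a + r * inner ℝ h x) ≤ Real.exp (r * inner ℝ h x) := by
      have := Real.add_one_le_exp (r * inner ℝ h x - a)
      calc Real.exp a * (1 - a + r * inner ℝ h x)
          ≤ Real.exp a * Real.exp (r * inner ℝ h x - a) := by gcongr; linarith
        _ = _ := by rw [← Real.exp_add]; ring_nf
    have := mul_le_mul_of_nonneg_left hconv (jointDensity_pos B r (x, w)).le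
    simp only [hshift]
    linarith
  calc Real.log (outputDensity μX B r w) + a
      = Real.log (Real.exp a * outputDensity μX B r w) := by
        rw [Real.log_mul (Real.exp_pos _).ne' hpos.ne', Real.log_exp, add_comm]
    _ ≤ _ := Real.log_le_log (mul_pos (Real.exp_pos _) hpos) hlow

/-- The output entropy lies above the line of slope `r E |E(x | Y)|²` through its value at `r`:
by Gibbs' inequality it decreases when `log ℓ_s` is replaced by `log ℓ_r` under the law of the
output at `s`, and the latter output is a shift of the output at `r` by `(s - r) x`. -/
theorem outputEntropy_subgradient (hW : IsAbstractWienerSpace ι μW)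
    (hB : IsPairing ι μX B) (hsq : Integrable (fun x : H => ‖x‖ ^ 2) μX) (r s : ℝ) :
    outputEntropy ι μX μW B r + (s - r) * (r * estimateEnergy ι μX μW B r) ≤
      outputEntropy ι μX μW B s := by
  have i1 := integrable_log_outputDensity hW hB hsq r
  have i2 := (integrable_inner_posteriorMean hW hB hsq r).const_mul ((s - r) * r)
  have hmq : AEStronglyMeasurable
      (fun w => 1 - outputDensity μX B r w / outputDensity μX B s w) μW :=
    (measurable_const.sub ((hB.stronglyMeasurable_outputDensity r).measurable.div
      (hB.stronglyMeasurable_outputDensity s).measurable)).aestronglyMeasurable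
  have hq : (fun w => outputDensity μX B s w •
      (1 - outputDensity μX B r w / outputDensity μX B s w)) =ᵐ[μW]
      fun w => outputDensity μX B s w - outputDensity μX B r w := by
    filter_upwards [ae_outputDensity_pos hW hB s] with w hw
    rw [smul_eq_mul, mul_sub, mul_div_cancel₀ _ hw.ne', mul_one]
  have i3 : Integrable (fun θ => 1 - outputDensity μX B r (output ι s θ) /
      outputDensity μX B s (output ι s θ)) (μX.prod μW) := by
    rw [integrable_output_iff hW hB s (g := fun w =>
      1 - outputDensity μX B r w / outputDensity μX B s w) hmq]
    exact ((integrable_outputDensity hW hB s).sub (integrable_outputDensity hW hB r)).congr hq.symm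
  have e3 : ∫ θ, (1 - outputDensity μX B r (output ι s θ) /
      outputDensity μX B s (output ι s θ)) ∂(μX.prod μW) = 0 := by
    rw [integral_output hW hB s (g := fun w =>
      1 - outputDensity μX B r w / outputDensity μX B s w) hmq, integral_congr_ae hq,
      integral_sub (integrable_outputDensity hW hB s) (integrable_outputDensity hW hB r),
      integral_outputDensity hW hB, integral_outputDensity hW hB, sub_self]
  have e := integral_add (i1.add i2) i3
  have e' := integral_add i1 i2
  simp only [Pi.add_apply] at e
  rw [e', e3, integral_const_mul, integral_inner_posteriorMean hW hB hsq, add_zero] at e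
  rw [outputEntropy, outputEntropy, estimateEnergy, ← mul_assoc, ← e]
  refine integral_mono_ae ((i1.add i2).add i3) (integrable_log_outputDensity hW hB hsq s) ?_
  filter_upwards [ae_output hW hB r (ae_integrable_jointDensity hW hB r),
    ae_output hW hB r (ae_integrable_weightedMean hW hB hsq r),
    ae_output hW hB s (ae_integrable_jointDensity hW hB r),
    ae_output hW hB r (ae_outputDensity_pos hW hB r),
    ae_output hW hB s (ae_outputDensity_pos hW hB r),
    ae_output hW hB s (ae_outputDensity_pos hW hB s)] with θ h0 h1 h2 hp1 hp2 hp3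
  have hout : output ι s θ = output ι r θ + ι ((s - r) • θ.1) := by
    simp only [output, ι.map_smul]; module
  have hJ := log_outputDensity_add_le hB r ((s - r) • θ.1) h0 h1 (by rwa [← hout]) hp1
  rw [← hout, inner_smul_left] at hJ
  have hG := Real.log_le_sub_one_of_pos (div_pos hp2 hp3)
  rw [Real.log_div hp2.ne' hp3.ne'] at hG
  simp only [conj_trivial] at hJ
  linarith

/-! ### Continuity of the energy of the estimate -/

/-- The distance of the joint densities at `s` and at `r`, weighted by `1 + |x|²` and integrated
over the signal. It bounds the change of the density, the mean and the energy of the posterior. -/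
def densityGap (μX : Measure H) (B : H → W →L[ℝ] ℝ) (r s : ℝ) (w : W) : ℝ :=
  ∫ x, |jointDensity B s (x, w) - jointDensity B r (x, w)| * (1 + ‖x‖ ^ 2) ∂μX

theorem integrable_abs_sub_jointDensity_mul (hW : IsAbstractWienerSpace ι μW)
    (hB : IsPairing ι μX B) (hsq : Integrable (fun x : H => ‖x‖ ^ 2) μX) (r s : ℝ) :
    Integrable (fun p : H × W => |jointDensity B s p - jointDensity B r p| * (1 + ‖p.1‖ ^ 2))
      (μX.prod μW) := by
  have hΨ : Integrable (fun x : H => 1 + ‖x‖ ^ 2) μX := (integrable_const 1).add hsq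
  refine (((integrable_jointDensity_smul hW hB s hΨ).sub
    (integrable_jointDensity_smul hW hB r hΨ)).norm).congr (ae_of_all _ fun p => ?_)
  have : (0 : ℝ) ≤ 1 + ‖p.1‖ ^ 2 := by positivity
  simp only [Pi.sub_apply, smul_eq_mul, ← sub_mul, norm_mul, Real.norm_eq_abs, abs_of_nonneg this]

/-- A weighted form of Scheffé's lemma: the joint densities converge pointwise and their weighted
integrals do not depend on the parameter. -/
theorem tendsto_integral_abs_sub_jointDensity (hW : IsAbstractWienerSpace ι μW)
    (hB : IsPairing ι μX B) (hsq : Integrable (fun x : H => ‖x‖ ^ 2) μX) (r : ℝ) :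
    Tendsto (fun s => ∫ p : H × W,
      |jointDensity B s p - jointDensity B r p| * (1 + ‖p.1‖ ^ 2) ∂(μX.prod μW))
      (𝓝 r) (𝓝 0) := by
  have hΨ : Integrable (fun x : H => 1 + ‖x‖ ^ 2) μX := (integrable_const 1).add hsq
  have hmeas : ∀ s, Measurable fun p : H × W =>
      max (jointDensity B r p - jointDensity B s p) 0 * (1 + ‖p.1‖ ^ 2) := fun s =>
    (((hB.measurable_jointDensity r).sub (hB.measurable_jointDensity s)).max
      measurable_const).mul (by fun_prop)
  have hbound : ∀ s (p : H × W),
      ‖max (jointDensity B r p - jointDensity B s p) 0 * (1 + ‖p.1‖ ^ 2)‖ ≤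
      jointDensity B r p • (1 + ‖p.1‖ ^ 2) := fun s p => by
    have h1 : (0 : ℝ) ≤ 1 + ‖p.1‖ ^ 2 := by positivity
    rw [Real.norm_eq_abs, abs_of_nonneg (mul_nonneg (le_max_right _ _) h1), smul_eq_mul]
    refine mul_le_mul_of_nonneg_right (max_le ?_ (jointDensity_pos _ _ _).le) h1
    linarith [jointDensity_pos B s p]
  have hint := integrable_jointDensity_smul hW hB r hΨ
  have hlim : Tendsto (fun s => ∫ p : H × W,
      max (jointDensity B r p - jointDensity B s p) 0 * (1 + ‖p.1‖ ^ 2) ∂(μX.prod μW))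
      (𝓝 r) (𝓝 (∫ _p : H × W, 0 ∂(μX.prod μW))) := by
    refine tendsto_integral_filter_of_dominated_convergence _
      (Eventually.of_forall fun s => (hmeas s).aestronglyMeasurable)
      (Eventually.of_forall fun s => ae_of_all _ (hbound s)) hint (ae_of_all _ fun p => ?_)
    have hc : Continuous fun s =>
        max (jointDensity B r p - jointDensity B s p) 0 * (1 + ‖p.1‖ ^ 2) := by
      unfold jointDensity; fun_prop
    simpa using hc.tendsto r
  have heq : ∀ s, ∫ p : H × W,
      |jointDensity B s p - jointDensity B r p| * (1 + ‖p.1‖ ^ 2) ∂(μX.prod μW) =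
      2 * ∫ p : H × W,
        max (jointDensity B r p - jointDensity B s p) 0 * (1 + ‖p.1‖ ^ 2) ∂(μX.prod μW) := by
    intro s
    have i1 : Integrable (fun p : H × W =>
        max (jointDensity B r p - jointDensity B s p) 0 * (1 + ‖p.1‖ ^ 2)) (μX.prod μW) :=
      hint.mono' (hmeas s).aestronglyMeasurable (ae_of_all _ (hbound s))
    have i2 := integrable_jointDensity_smul hW hB s hΨ
    have e1 := integral_add (i1.const_mul 2) (i2.sub hint)
    have e2 := integral_sub i2 hint
    rw [integral_jointDensity_smul hW hB s hΨ.1, integral_jointDensity_smul hW hB r hΨ.1,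
      sub_self] at e2
    simp only [Pi.sub_apply] at e1
    rw [e2, add_zero, integral_const_mul] at e1
    rw [← e1]
    refine integral_congr_ae (ae_of_all _ fun p => ?_)
    simp only [smul_eq_mul]
    rcases le_total (jointDensity B s p) (jointDensity B r p) with h | h
    · rw [abs_of_nonpos (sub_nonpos.2 h), max_eq_left (sub_nonneg.2 h)]; ring
    · rw [abs_of_nonneg (sub_nonneg.2 h), max_eq_right (sub_nonpos.2 h)]; ring
  simp only [heq]
  simpa using hlim.const_mul 2

theorem densityGap_nonneg (r s : ℝ) (w : W) : 0 ≤ densityGap μX B r s w :=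
  integral_nonneg fun x => mul_nonneg (abs_nonneg _) (by positivity)

theorem integrable_densityGap (hW : IsAbstractWienerSpace ι μW)
    (hB : IsPairing ι μX B) (hsq : Integrable (fun x : H => ‖x‖ ^ 2) μX) (r s : ℝ) :
    Integrable (densityGap μX B r s) μW :=
  (integrable_abs_sub_jointDensity_mul hW hB hsq r s).integral_prod_right

theorem tendsto_integral_densityGap (hW : IsAbstractWienerSpace ι μW)
    (hB : IsPairing ι μX B) (hsq : Integrable (fun x : H => ‖x‖ ^ 2) μX) (r : ℝ) :
    Tendsto (fun s => ∫ w, densityGap μX B r s w ∂μW) (𝓝 r) (𝓝 0) := by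
  refine (tendsto_integral_abs_sub_jointDensity hW hB hsq r).congr fun s => ?_
  rw [integral_prod_symm _ (integrable_abs_sub_jointDensity_mul hW hB hsq r s)]
  rfl

/-- The weighted integrals over the signal of functions dominated by `1 + |x|²` change by at most
the density gap. -/
theorem norm_integral_jointDensity_sub_le {E : Type*} [NormedAddCommGroup E] [NormedSpace ℝ E]
    {r s : ℝ} {w : W} {g : H → E} (hg : ∀ x, ‖g x‖ ≤ 1 + ‖x‖ ^ 2)
    (hs : Integrable (fun x => jointDensity B s (x, w) • g x) μX)
    (hr : Integrable (fun x => jointDensity B r (x, w) • g x) μX)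
    (hgap : Integrable (fun x => |jointDensity B s (x, w) - jointDensity B r (x, w)| *
      (1 + ‖x‖ ^ 2)) μX) :
    ‖(∫ x, jointDensity B s (x, w) • g x ∂μX) - ∫ x, jointDensity B r (x, w) • g x ∂μX‖ ≤
      densityGap μX B r s w := by
  rw [← integral_sub hs hr]
  refine norm_integral_le_of_norm_le hgap (ae_of_all _ fun x => ?_)
  rw [← sub_smul, norm_smul, Real.norm_eq_abs]
  exact mul_le_mul_of_nonneg_left (hg x) (abs_nonneg _)

theorem ae_densityGap_bounds (hW : IsAbstractWienerSpace ι μW)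
    (hB : IsPairing ι μX B) (hsq : Integrable (fun x : H => ‖x‖ ^ 2) μX) (r s : ℝ) :
    ∀ᵐ w ∂μW,
      |outputDensity μX B s w - outputDensity μX B r w| ≤ densityGap μX B r s w ∧
      ‖weightedMean μX B s w - weightedMean μX B r w‖ ≤ densityGap μX B r s w ∧
      |weightedEnergy μX B s w - weightedEnergy μX B r w| ≤ densityGap μX B r s w := by
  filter_upwards [ae_integrable_jointDensity hW hB r, ae_integrable_jointDensity hW hB s,
    ae_integrable_weightedMean hW hB hsq r, ae_integrable_weightedMean hW hB hsq s,
    ae_integrable_weightedEnergy hW hB hsq r, ae_integrable_weightedEnergy hW hB hsq s,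
    (integrable_abs_sub_jointDensity_mul hW hB hsq r s).prod_left_ae]
    with w h1 h2 h3 h4 h5 h6 hgap
  refine ⟨?_, ?_, ?_⟩
  · have := norm_integral_jointDensity_sub_le (r := r) (s := s) (w := w) (B := B) (μX := μX)
      (g := fun _ => (1 : ℝ)) (fun x => by simp) (by simpa using h2) (by simpa using h1) hgap
    simpa [outputDensity] using this
  · refine norm_integral_jointDensity_sub_le (fun x => ?_) h4 h3 hgap
    nlinarith [sq_nonneg (‖x‖ - 1), sq_nonneg ‖x‖]
  · refine norm_integral_jointDensity_sub_le (g := fun x => ‖x‖ ^ 2) (fun x => ?_) h6 h5 hgap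
    simp

/-- Along any sequence of parameters tending to `r` a subsequence of the densities and of the means
converges almost everywhere; the posterior energies dominate, and they converge in `L¹`. -/
theorem continuous_estimateEnergy (hW : IsAbstractWienerSpace ι μW)
    (hB : IsPairing ι μX B) (hsq : Integrable (fun x : H => ‖x‖ ^ 2) μX) :
    Continuous (estimateEnergy ι μX μW B) := by
  refine continuous_iff_continuousAt.2 fun r => tendsto_of_subseq_tendsto fun ns hns => ?_
  have hgap := (tendsto_integral_densityGap hW hB hsq r).comp hns
  have hmeasure : TendstoInMeasure μW (fun n => densityGap μX B r (ns n)) atTop 0 := by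
    refine tendstoInMeasure_of_tendsto_eLpNorm (p := 1) one_ne_zero
      (fun n => (integrable_densityGap hW hB hsq r (ns n)).1) aestronglyMeasurable_zero ?_
    have : ∀ n, eLpNorm (densityGap μX B r (ns n) - 0) 1 μW =
        ENNReal.ofReal (∫ w, densityGap μX B r (ns n) w ∂μW) := fun n => by
      rw [sub_zero, eLpNorm_one_eq_lintegral_enorm, ofReal_integral_eq_lintegral_ofReal
        (integrable_densityGap hW hB hsq r (ns n)) (ae_of_all _ fun w => densityGap_nonneg r _ w)]
      exact lintegral_congr fun w => Real.enorm_of_nonneg (densityGap_nonneg r _ w)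
    simp only [this]
    simpa using ENNReal.tendsto_ofReal hgap
  obtain ⟨ms, hms, hae⟩ := hmeasure.exists_seq_tendsto_ae
  refine ⟨ms, ?_⟩
  have hgap' := hgap.comp hms.tendsto_atTop
  simp only [estimateEnergy, integral_norm_sq_posteriorMean hW hB]
  set f : ℝ → W → ℝ := fun s w => outputDensity μX B s w * ‖posteriorMean μX B s w‖ ^ 2
  have hfi : ∀ s, Integrable (f s) μW := integrable_outputDensity_mul_norm_sq hW hB hsq
  have hf0 : ∀ s w, 0 ≤ f s w := fun s w =>
    mul_nonneg (outputDensity_nonneg _ _ _ _) (sq_nonneg _)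
  have hQi := integrable_weightedEnergy hW hB hsq r
  have hbounds : ∀ᵐ w ∂μW, ∀ n, _ :=
    ae_all_iff.2 fun n => ae_densityGap_bounds hW hB hsq r (ns (ms n))
  have hflim : ∀ᵐ w ∂μW, Tendsto (fun n => f (ns (ms n)) w) atTop (𝓝 (f r w)) := by
    filter_upwards [hae, hbounds, ae_outputDensity_pos hW hB r] with w h0 hb hpos
    have hden : Tendsto (fun n => outputDensity μX B (ns (ms n)) w) atTop
        (𝓝 (outputDensity μX B r w)) :=
      tendsto_iff_norm_sub_tendsto_zero.2
        (squeeze_zero (fun n => norm_nonneg _) (fun n => (hb n).1) h0)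
    have hmean : Tendsto (fun n => weightedMean μX B (ns (ms n)) w) atTop
        (𝓝 (weightedMean μX B r w)) :=
      tendsto_iff_norm_sub_tendsto_zero.2
        (squeeze_zero (fun n => norm_nonneg _) (fun n => (hb n).2.1) h0)
    exact hden.mul (((hden.inv₀ hpos.ne').smul hmean).norm.pow 2)
  -- The functions `f s` are truncated at the energy at `r`, so that dominated convergence applies.
  have hmin : Tendsto (fun n => ∫ w, min (f (ns (ms n)) w) (weightedEnergy μX B r w) ∂μW) atTop
      (𝓝 (∫ w, f r w ∂μW)) := by
    refine tendsto_integral_of_dominated_convergence (weightedEnergy μX B r)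
      (fun n => ((hfi _).inf hQi).1) hQi (fun n => ?_) ?_
    · filter_upwards [outputDensity_mul_norm_sq_le hW hB hsq r] with w hw
      rw [Real.norm_eq_abs, abs_of_nonneg (le_min (hf0 _ _) ((hf0 r w).trans hw))]
      exact min_le_right _ _
    · filter_upwards [hflim, outputDensity_mul_norm_sq_le hW hB hsq r] with w h1 hw
      have := h1.min (tendsto_const_nhds (x := weightedEnergy μX B r w))
      rwa [min_eq_left hw] at this
  have hdiff : Tendsto (fun n => ∫ w, (f (ns (ms n)) w -
      min (f (ns (ms n)) w) (weightedEnergy μX B r w)) ∂μW) atTop (𝓝 0) := by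
    refine squeeze_zero (fun n => integral_nonneg fun w => sub_nonneg.2 (min_le_left _ _))
      (fun n => ?_) hgap'
    refine integral_mono_ae ((hfi _).sub ((hfi _).inf hQi))
      (integrable_densityGap hW hB hsq r _) ?_
    filter_upwards [hbounds, outputDensity_mul_norm_sq_le hW hB hsq (ns (ms n))] with w hb hw
    have h1 := (abs_le.1 (hb n).2.2).2
    have h2 := densityGap_nonneg (μX := μX) (B := B) r (ns (ms n)) w
    rcases le_total (f (ns (ms n)) w) (weightedEnergy μX B r w) with h | h
    · rw [min_eq_left h, sub_self]; exact h2
    · rw [min_eq_right h]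
      have h3 : f (ns (ms n)) w ≤ weightedEnergy μX B (ns (ms n)) w := hw
      linarith
  have hsum := hdiff.add hmin
  rw [zero_add] at hsum
  refine hsum.congr fun n => ?_
  have e := integral_add ((hfi (ns (ms n))).sub ((hfi (ns (ms n))).inf hQi))
    ((hfi (ns (ms n))).inf hQi)
  simp only [Pi.sub_apply, Pi.inf_apply, sub_add_cancel] at e
  exact e.symm

end Channel

/-! ### Differentiation of the mutual information -/

/-- A function with a continuous selection of subgradients is differentiable. -/
theorem hasDerivAt_of_subgradient {D g : ℝ → ℝ} (h : ∀ r s, D r + (s - r) * g r ≤ D s)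
    (hg : Continuous g) (r : ℝ) : HasDerivAt D (g r) r := by
  rw [hasDerivAt_iff_isLittleO, Asymptotics.isLittleO_iff]
  intro c hc
  have hev : ∀ᶠ s in 𝓝 r, ‖g s - g r‖ ≤ c := by
    filter_upwards [Metric.tendsto_nhds.1 (hg.tendsto r) c hc] with s hs
    rw [← dist_eq_norm]
    exact hs.le
  filter_upwards [hev] with s hs
  have h1 := h r s
  have h2 := h s r
  have h3 : ‖D s - D r - (s - r) • g r‖ ≤ ‖(g s - g r) * (s - r)‖ := by
    rw [smul_eq_mul, Real.norm_of_nonneg (by linarith)]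
    refine le_trans ?_ (Real.le_norm_self _)
    linarith
  rw [norm_mul] at h3
  exact h3.trans (mul_le_mul_of_nonneg_right hs (norm_nonneg _))

end GaussianChannel

end

theorem proposition5p1 {H W : Type*}
    [NormedAddCommGroup H] [InnerProductSpace ℝ H] [CompleteSpace H]
    [SecondCountableTopology H] [MeasurableSpace H] [BorelSpace H]
    [NormedAddCommGroup W] [NormedSpace ℝ W] [CompleteSpace W]
    [SecondCountableTopology W] [MeasurableSpace W] [BorelSpace W]
    (ι : H →L[ℝ] W) (μW : Measure W) [IsProbabilityMeasure μW]
    (hW : GaussianChannel.IsAbstractWienerSpace ι μW)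
    (μX : Measure H) [IsProbabilityMeasure μX]
    -- the signal takes values in `W*`
    (hX : ∀ᵐ x ∂μX, x ∈ Set.range (GaussianChannel.dualToH ι))
    -- exponential moments in the directions of `W*`
    (hexp : ∀ (α : ℝ) (e : W →L[ℝ] ℝ),
      Integrable (fun x : H => Real.exp (α * inner ℝ x (GaussianChannel.dualToH ι e))) μX)
    -- finite signal energy
    (hsq : Integrable (fun x : H => ‖x‖ ^ 2) μX)
    (ρ : ℝ) :
    -- the mutual information is well defined and finite
    (μX.prod μW).map (fun θ => (GaussianChannel.signal θ, GaussianChannel.output ι ρ θ)) ≪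
        ((μX.prod μW).map GaussianChannel.signal).prod
          ((μX.prod μW).map (GaussianChannel.output ι ρ)) ∧
    Integrable
      (llr ((μX.prod μW).map
          (fun θ => (GaussianChannel.signal θ, GaussianChannel.output ι ρ θ)))
        (((μX.prod μW).map GaussianChannel.signal).prod
          ((μX.prod μW).map (GaussianChannel.output ι ρ))))
      ((μX.prod μW).map
        (fun θ => (GaussianChannel.signal θ, GaussianChannel.output ι ρ θ))) ∧
    -- the derivative formula, in its two forms
    Integrable (fun θ : H × W => ‖GaussianChannel.estimate ι μX μW ρ θ‖ ^ 2) (μX.prod μW) ∧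
    Integrable (fun θ : H × W =>
      ‖GaussianChannel.signal θ - GaussianChannel.estimate ι μX μW ρ θ‖ ^ 2) (μX.prod μW) ∧
    HasDerivAt (fun r : ℝ => GaussianChannel.channelInfo ι μX μW r)
      (ρ * ∫ θ : H × W, (‖GaussianChannel.signal θ‖ ^ 2
        - ‖GaussianChannel.estimate ι μX μW ρ θ‖ ^ 2) ∂(μX.prod μW)) ρ ∧
    HasDerivAt (fun r : ℝ => GaussianChannel.channelInfo ι μX μW r)
      (ρ * ∫ θ : H × W, ‖GaussianChannel.signal θ - GaussianChannel.estimate ι μX μW ρ θ‖ ^ 2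
        ∂(μX.prod μW)) ρ ∧
    -- the relation with the relative entropy of the output law with respect to `μW`
    GaussianChannel.outputLaw ι μX μW ρ ≪ μW ∧
    Integrable (fun w => Real.log (GaussianChannel.likelihoodRatio ι μX μW ρ w))
      (GaussianChannel.outputLaw ι μX μW ρ) ∧
    GaussianChannel.channelInfo ι μX μW ρ =
      ρ ^ 2 / 2 * ∫ θ : H × W, ‖GaussianChannel.signal θ‖ ^ 2 ∂(μX.prod μW)
        - ∫ w, Real.log (GaussianChannel.likelihoodRatio ι μX μW ρ w)
            ∂(GaussianChannel.outputLaw ι μX μW ρ) := by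
  obtain ⟨B, hB⟩ := GaussianChannel.exists_isPairing ι hW.denseRange μX hX
  have hest := GaussianChannel.estimate_ae_eq hW hB hsq ρ
  have hener : ∫ θ : H × W, ‖GaussianChannel.estimate ι μX μW ρ θ‖ ^ 2 ∂(μX.prod μW) =
      GaussianChannel.estimateEnergy ι μX μW B ρ :=
    integral_congr_ae (hest.mono fun θ hθ => by simp only [hθ])
  obtain ⟨herr, herr'⟩ := GaussianChannel.integral_norm_sub_posteriorMean_sq hW hB hsq ρ
  have hestsq : Integrable (fun θ : H × W => ‖GaussianChannel.estimate ι μX μW ρ θ‖ ^ 2)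
      (μX.prod μW) :=
    (GaussianChannel.integrable_norm_sq_posteriorMean hW hB hsq ρ).congr
      (hest.mono fun θ hθ => by simp only [hθ])
  have herrEq : (fun θ : H × W => ‖θ.1 - GaussianChannel.posteriorMean μX B ρ
      (GaussianChannel.output ι ρ θ)‖ ^ 2) =ᵐ[μX.prod μW] fun θ =>
      ‖GaussianChannel.signal θ - GaussianChannel.estimate ι μX μW ρ θ‖ ^ 2 :=
    hest.mono fun θ hθ => by simp only [hθ, GaussianChannel.signal]
  have hsig : Integrable (fun θ : H × W => ‖GaussianChannel.signal θ‖ ^ 2) (μX.prod μW) :=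
    hsq.comp_fst μW
  have hsigEq : ∫ θ : H × W, ‖GaussianChannel.signal θ‖ ^ 2 ∂(μX.prod μW) =
      ∫ x, ‖x‖ ^ 2 ∂μX := by
    simpa [GaussianChannel.signal] using
      integral_fun_fst (μ := μX) (ν := μW) (fun x : H => ‖x‖ ^ 2)
  have hmmse : ∫ θ : H × W, ‖GaussianChannel.signal θ - GaussianChannel.estimate ι μX μW ρ θ‖ ^ 2
      ∂(μX.prod μW) = ∫ θ : H × W, (‖GaussianChannel.signal θ‖ ^ 2
        - ‖GaussianChannel.estimate ι μX μW ρ θ‖ ^ 2) ∂(μX.prod μW) := by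
    rw [← integral_congr_ae herrEq, herr']
    exact integral_congr_ae (hest.mono fun θ hθ => by simp only [hθ, GaussianChannel.signal])
  have hderiv : HasDerivAt (fun r : ℝ => GaussianChannel.channelInfo ι μX μW r)
      (ρ * ∫ θ : H × W, (‖GaussianChannel.signal θ‖ ^ 2
        - ‖GaussianChannel.estimate ι μX μW ρ θ‖ ^ 2) ∂(μX.prod μW)) ρ := by
    have h1 := GaussianChannel.hasDerivAt_of_subgradient
      (GaussianChannel.outputEntropy_subgradient hW hB hsq)
      (continuous_id.mul (GaussianChannel.continuous_estimateEnergy hW hB hsq)) ρ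
    have h2 := ((((hasDerivAt_id ρ).pow 2).div_const 2).mul_const (∫ x, ‖x‖ ^ 2 ∂μX)).sub h1
    have h3 : (fun r : ℝ => GaussianChannel.channelInfo ι μX μW r) = fun r =>
        r ^ 2 / 2 * ∫ x, ‖x‖ ^ 2 ∂μX - GaussianChannel.outputEntropy ι μX μW B r :=
      funext fun r => GaussianChannel.channelInfo_eq hW hB hsq r
    rw [h3, integral_sub hsig hestsq, hener, hsigEq]
    refine HasDerivAt.congr_deriv h2 ?_
    simp only [id_eq]
    norm_num
    ring
  have hac := GaussianChannel.outputLaw_absolutelyContinuous hW hB ρ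
  have hlog : (fun w => Real.log (GaussianChannel.likelihoodRatio ι μX μW ρ w))
      =ᵐ[GaussianChannel.outputLaw ι μX μW ρ]
      fun w => Real.log (GaussianChannel.outputDensity μX B ρ w) :=
    Filter.Eventually.mono (hac.ae_le (GaussianChannel.likelihoodRatio_ae_eq hW hB ρ))
      fun w hw => congrArg Real.log hw
  have hlogm : AEStronglyMeasurable (fun w => Real.log (GaussianChannel.outputDensity μX B ρ w))
      (GaussianChannel.outputLaw ι μX μW ρ) :=
    (hB.stronglyMeasurable_outputDensity ρ).measurable.log.aestronglyMeasurable
  have hout := (GaussianChannel.measurable_output (H := H) ι ρ).aemeasurable (μ := μX.prod μW)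
  refine ⟨GaussianChannel.map_signal_output_absolutelyContinuous hW hB ρ,
    GaussianChannel.integrable_llr_signal_output hW hB hsq ρ, hestsq, herr.congr herrEq,
    hderiv, ?_, hac, ?_, ?_⟩
  · rw [hmmse]
    exact hderiv
  · exact ((integrable_map_measure hlogm hout).2
      (GaussianChannel.integrable_log_outputDensity hW hB hsq ρ)).congr hlog.symm
  · rw [GaussianChannel.channelInfo_eq hW hB hsq, hsigEq, integral_congr_ae hlog,
      GaussianChannel.outputLaw, integral_map hout hlogm]
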